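/- Let $\mathcal H$ and $\mathcal G$ be real Hilbert spaces. For a real Hilbert space $\mathcal E$, set $\mathscr Q_{\mathcal E}=\|\cdot\|_{\mathcal E}^2/2$, and let $\Gamma_0(\mathcal E)$ be the class of lower semicontinuous convex functions $f\colon\mathcal E\to\left]-\infty,+\infty\right]$ that are proper, i.e., not identically $+\infty$. The conjugate of $f\colon\mathcal E\to[-\infty,+\infty]$ is $f^*\colon u\mapsto\sup_{x\in\mathcal E}\big(\langle x,u\rangle-f(x)\big)$, and the infimal convolution of $f,h\colon\mathcal E\to\left]-\infty,+\infty\right]$ is $f\mathbin{\square}h\colon x\mapsto\inf_{z\in\mathcal E}\big(f(z)+h(x-z)\big)$. For $c\in\left]0,+\infty\right[$, a function $f\in\Gamma_0(\mathcal E)$ is called $c$-strongly convex if $f-c\,\mathscr Q_{\mathcal E}$ is convex. For a bounded linear operator $L\colon\mathcal H\to\mathcal G$ and a proper function $g\colon\mathcal G\to\left]-\infty,+\infty\right]$, the proximal composition of $g$ with $L$ is $$L\diamond g=\big((g^*\mathbin{\square}\mathscr Q_{\mathcal G})\circ L\big)^*-\mathscr Q_{\mathcal H}.$$ **Proposition.**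 Let $L\colon\mathcal H\to\mathcal G$ be a bounded linear operator with $0<\|L\|\leq 1$, let $\alpha\in\left[0,+\infty\right[$, let $g\in\Gamma_0(\mathcal G)$ be such that $g-\alpha\mathscr Q_{\mathcal G}$ is convex, and set $\beta=(\alpha+1)\|L\|^{-2}-1$. Suppose that $\alpha>0$ or $\|L\|<1$. Then $L\diamond g$ is $\beta$-strongly convex; that is, $\beta>0$, $L\diamond g\in\Gamma_0(\mathcal H)$, and $(L\diamond g)-\beta\mathscr Q_{\mathcal H}$ is convex. -/

import Mathlib

noncomputable section

namespace ProxComp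

/-- The canonical quadratic form `Q_E = ‖·‖² / 2` of a real Hilbert space. -/
def quad {E : Type*} [NormedAddCommGroup E] [InnerProductSpace ℝ E] (x : E) : ℝ :=
  ‖x‖ ^ 2 / 2

/-- Convexity of an extended-real-valued function: its epigraph
`{(x, ξ) ∈ E × ℝ | f x ≤ ξ}` is convex. -/
def IsConvex {E : Type*} [NormedAddCommGroup E] [InnerProductSpace ℝ E]
    (f : E → EReal) : Prop :=
  Convex ℝ {p : E × ℝ | f p.1 ≤ (p.2 : EReal)}

/-- The class `Γ₀(E)` of proper lower semicontinuous convex functions from `E` to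
`]-∞, +∞]`. -/
structure IsGammaZero {E : Type*} [NormedAddCommGroup E] [InnerProductSpace ℝ E]
    (f : E → EReal) : Prop where
  ne_bot : ∀ x, f x ≠ ⊥
  proper : ∃ x, f x < ⊤
  lsc : LowerSemicontinuous f
  convex : IsConvex f

/-- The function `f - c Q_E`. -/
def subQuad {E : Type*} [NormedAddCommGroup E] [InnerProductSpace ℝ E]
    (f : E → EReal) (c : ℝ) (x : E) : EReal :=
  f x - ((c * quad x : ℝ) : EReal)

/-- `c`-strong convexity of `f`: `f ∈ Γ₀(E)`, `c ∈ ]0, +∞[` and `f - c Q_E` is convex. -/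
structure IsStronglyConvex {E : Type*} [NormedAddCommGroup E] [InnerProductSpace ℝ E]
    (c : ℝ) (f : E → EReal) : Prop where
  gammaZero : IsGammaZero f
  pos : 0 < c
  convex : IsConvex (subQuad f c)

/-- The (Fenchel) conjugate `f^*(u) = sup_x (⟪x, u⟫ - f x)`. -/
def conjugate {E : Type*} [NormedAddCommGroup E] [InnerProductSpace ℝ E]
    (f : E → EReal) (u : E) : EReal :=
  ⨆ x : E, ((inner ℝ x u : ℝ) : EReal) - f x

/-- The infimal convolution `(f □ h)(x) = inf_z (f z + h (x - z))` of two functions with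
values in `]-∞, +∞]`. -/
def infConv {E : Type*} [NormedAddCommGroup E] [InnerProductSpace ℝ E]
    (f h : E → EReal) (x : E) : EReal :=
  ⨅ z : E, f z + h (x - z)

/-- The proximal composition `((g^* □ Q_G) ∘ L)^* - Q_H` of a proper function
`g : G → ]-∞, +∞]` with a bounded linear operator `L : H → G`. -/
def proxComp {H G : Type*} [NormedAddCommGroup H] [InnerProductSpace ℝ H]
    [NormedAddCommGroup G] [InnerProductSpace ℝ G] (L : H →L[ℝ] G) (g : G → EReal)
    (x : H) : EReal :=
  conjugate (fun v : H => infConv (conjugate g) (fun y : G => (quad y : EReal)) (L v)) x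
    - (quad x : EReal)

end ProxComp

end

namespace ProxComp

variable {E : Type*} [NormedAddCommGroup E] [InnerProductSpace ℝ E]

/-! Strong convexity of `g` turns into smoothness on the dual side. If `p` is the proximal point of
`g` at `y`, then `y - p` is a subgradient of `g` at `p` with an extra `α`-quadratic gain, so `g^* □
Q` is finite and lies below a quadratic of curvature `1 / (α + 1)` and slope `p` touching it at `y`
(`descent_infConv_conjugate`). Composing with `L` scales the curvature by `‖L‖ ^ 2`, giving `1 / (β
+ 1)`. Conjugating yields a supremum of quadratics of curvature `β + 1`
(`conjugate_le_iff_of_descent`); subtracting `Q` leaves curvature `β`. Since proximal points are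
built directly, no biconjugation is needed. -/

theorem quad_nonneg (x : E) : 0 ≤ quad x := by unfold quad; positivity

theorem quad_add (x y : E) : quad (x + y) = quad x + inner ℝ x y + quad y := by
  unfold quad; rw [norm_add_sq_real]; ring

theorem quad_sub (x y : E) : quad (x - y) = quad x - inner ℝ x y + quad y := by
  unfold quad; rw [norm_sub_sq_real]; ring

theorem quad_smul (t : ℝ) (x : E) : quad (t • x) = t ^ 2 * quad x := by
  unfold quad; rw [norm_smul, mul_pow, Real.norm_eq_abs, sq_abs]; ring

theorem continuous_quad : Continuous (quad : E → ℝ) := by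
  unfold quad; fun_prop

/-! ### Proximal points in `Γ₀` -/

theorem IsConvex.apply_le {f : E → EReal} (hf : IsConvex f) {x y : E} {a b s t : ℝ}
    (hx : f x ≤ a) (hy : f y ≤ b) (hs : 0 ≤ s) (ht : 0 ≤ t) (hst : s + t = 1) :
    f (s • x + t • y) ≤ ((s * a + t * b : ℝ) : EReal) :=
  hf (x := (x, a)) hx (y := (y, b)) hy hs ht hst

theorem IsGammaZero.exists_eq_coe {f : E → EReal} (hf : IsGammaZero f) :
    ∃ (x : E) (a : ℝ), f x = a := by
  obtain ⟨x, hx⟩ := hf.proper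
  exact ⟨x, (f x).toReal, (EReal.coe_toReal hx.ne (hf.ne_bot x)).symm⟩

/-- A function in `Γ₀(E)` decreases at most linearly. -/
theorem IsGammaZero.exists_linear_lower_bound {f : E → EReal} (hf : IsGammaZero f) (y : E) :
    ∃ a k : ℝ, ∀ (x : E) (b : ℝ), f x ≤ b → a - k * ‖x - y‖ ≤ b := by
  obtain ⟨x₀, a, ha⟩ := hf.exists_eq_coe
  have hlt : ((a - 1 : ℝ) : EReal) < f x₀ := by
    rw [ha]; exact_mod_cast sub_one_lt a
  obtain ⟨r, hr, hball⟩ := Metric.eventually_nhds_iff.1 (hf.lsc x₀ _ hlt)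
  refine ⟨a - 1 - 2 / r * ‖y - x₀‖, 2 / r, fun x b hb => ?_⟩
  have htri : ‖x - x₀‖ ≤ ‖x - y‖ + ‖y - x₀‖ := by
    simpa using norm_add_le (x - y) (y - x₀)
  have hk : (0 : ℝ) < 2 / r := by positivity
  suffices hs : a - 1 - 2 / r * ‖x - x₀‖ ≤ b by nlinarith
  rcases lt_or_ge ‖x - x₀‖ r with hd | hd
  · have h1 := (hball (by rwa [dist_eq_norm])).trans_le hb
    have h2 : a - 1 < b := by exact_mod_cast h1
    have : 0 ≤ 2 / r * ‖x - x₀‖ := by positivity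
    linarith
  · have hd0 : 0 < ‖x - x₀‖ := hr.trans_le hd
    -- This `t` puts the point of the segment at distance `r / 2` from `x₀`, where `f > a - 1`.
    set t : ℝ := r / (2 * ‖x - x₀‖) with ht
    have ht0 : 0 < t := by positivity
    have ht1 : t ≤ 1 := by rw [ht, div_le_one (by positivity)]; linarith
    have hc := hf.convex.apply_le ha.le hb (sub_nonneg.2 ht1) ht0.le (by ring)
    have hmem : dist ((1 - t) • x₀ + t • x) x₀ < r := by
      have : (1 - t) • x₀ + t • x - x₀ = t • (x - x₀) := by module
      rw [dist_eq_norm, this, norm_smul, Real.norm_of_nonneg ht0.le, ht]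
      field_simp
      linarith
    have h2 : a - 1 < (1 - t) * a + t * b := by exact_mod_cast (hball hmem).trans_le hc
    have h3 : t * (2 / r * ‖x - x₀‖) = 1 := by rw [ht]; field_simp
    by_contra! hcon
    nlinarith [mul_lt_mul_of_pos_left hcon ht0]

/-- The proximal point: `f + quad (· - y)` attains its minimum. -/
theorem IsGammaZero.exists_prox [CompleteSpace E] {f : E → EReal} (hf : IsGammaZero f) (y : E) :
    ∃ (p : E) (r : ℝ), f p = r ∧
      ∀ (x : E) (b : ℝ), f x ≤ b → r + quad (p - y) ≤ b + quad (x - y) := by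
  obtain ⟨a, k, hak⟩ := hf.exists_linear_lower_bound y
  obtain ⟨x₀, a₀, hx₀⟩ := hf.exists_eq_coe
  set S : Set ℝ := {s | ∃ (x : E) (b : ℝ), f x ≤ b ∧ b + quad (x - y) = s} with hS
  have hne : S.Nonempty := ⟨_, x₀, a₀, hx₀.le, rfl⟩
  have hbdd : BddBelow S := by
    refine ⟨a - k ^ 2 / 2, ?_⟩
    rintro s ⟨x, b, hb, rfl⟩
    have := hak x b hb
    unfold quad
    nlinarith [sq_nonneg (‖x - y‖ - k)]
  set m := sInf S with hm
  have hmle : ∀ (x : E) (b : ℝ), f x ≤ b → m ≤ b + quad (x - y) :=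
    fun x b hb => csInf_le hbdd ⟨x, b, hb, rfl⟩
  have hex : ∀ n : ℕ, ∃ (x : E) (b : ℝ), f x ≤ b ∧ b + quad (x - y) < m + 1 / ((n : ℝ) + 1) := by
    intro n
    obtain ⟨s, ⟨x, b, hb, rfl⟩, hs⟩ :=
      exists_lt_of_csInf_lt hne (lt_add_of_pos_right m (Nat.one_div_pos_of_nat (α := ℝ) (n := n)))
    exact ⟨x, b, hb, hs⟩
  choose x b hb hlt using hex
  -- Minimality at the midpoint and the parallelogram identity make the minimizing sequence Cauchy.
  have hgap : ∀ i j, quad (x i - x j) ≤ 2 * (1 / ((i : ℝ) + 1) + 1 / ((j : ℝ) + 1)) := by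
    intro i j
    have h1 := hmle _ _ (hf.convex.apply_le (hb i) (hb j) (s := 1 / 2) (t := 1 / 2)
      (by norm_num) (by norm_num) (by norm_num))
    have h2 : ((1 / 2 : ℝ) • x i + (1 / 2 : ℝ) • x j) - y
        = (1 / 2 : ℝ) • ((x i - y) + (x j - y)) := by module
    have h3 : x i - x j = (x i - y) - (x j - y) := by abel
    rw [h2, quad_smul, quad_add] at h1
    rw [h3, quad_sub]
    linarith [hlt i, hlt j]
  have hcauchy : CauchySeq x := by
    rw [Metric.cauchySeq_iff']
    intro ε hε
    obtain ⟨N, hN⟩ := exists_nat_one_div_lt (show (0 : ℝ) < ε ^ 2 / 8 by positivity)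
    refine ⟨N, fun n hn => ?_⟩
    have h1 := hgap n N
    have h2 : 1 / ((n : ℝ) + 1) ≤ 1 / ((N : ℝ) + 1) := Nat.one_div_le_one_div hn
    unfold quad at h1
    rw [dist_eq_norm]
    exact lt_of_pow_lt_pow_left₀ 2 hε.le (by linarith)
  obtain ⟨p, hp⟩ := cauchySeq_tendsto_of_complete hcauchy
  have hle : f p ≤ ((m - quad (p - y) : ℝ) : EReal) := by
    refine EReal.ge_of_forall_gt_iff_ge.1 fun c hc => ?_
    rw [EReal.coe_le_coe_iff]
    have hlim : Filter.Tendsto (fun n : ℕ => m + 1 / ((n : ℝ) + 1) - quad (x n - y)) Filter.atTop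
        (nhds (m + 0 - quad (p - y))) :=
      (tendsto_const_nhds.add tendsto_one_div_add_atTop_nhds_zero_nat).sub
        ((continuous_quad.tendsto _).comp (hp.sub_const y))
    rw [add_zero] at hlim
    refine ge_of_tendsto hlim ?_
    filter_upwards [hp.eventually (hf.lsc p c hc)] with n hn
    have h1 : c < b n := by exact_mod_cast hn.trans_le (hb n)
    linarith [hlt n]
  have hcoe := EReal.coe_toReal (ne_top_of_le_ne_top (EReal.coe_ne_top _) hle) (hf.ne_bot p)
  refine ⟨p, (f p).toReal, hcoe.symm, fun z c hz => ?_⟩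
  rw [← hcoe] at hle
  have h1 : (f p).toReal ≤ m - quad (p - y) := by exact_mod_cast hle
  linarith [hmle z c hz]

/-- First-order optimality: compare `p` with `p + t • (x - p)`, divide by `t` and let `t → 0`. -/
theorem IsGammaZero.exists_prox_subgradient [CompleteSpace E] {f : E → EReal}
    (hf : IsGammaZero f) {α : ℝ} (hα : IsConvex (subQuad f α)) (y : E) :
    ∃ (p : E) (r : ℝ), f p = r ∧
      ∀ (x : E) (b : ℝ), f x ≤ b → r + inner ℝ (y - p) (x - p) + α * quad (x - p) ≤ b := by
  obtain ⟨p, r, hp, hmin⟩ := hf.exists_prox y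
  refine ⟨p, r, hp, fun x b hb => ?_⟩
  have key : ∀ t : ℝ, 0 < t → t ≤ 1 →
      r + inner ℝ (y - p) (x - p) + α * quad (x - p) ≤ b + t * ((α + 1) * quad (x - p)) := by
    intro t ht ht1
    have hsub : ∀ {z : E} {c : ℝ}, f z ≤ c → subQuad f α z ≤ ((c - α * quad z : ℝ) : EReal) := by
      intro z c h
      rw [EReal.coe_sub]
      exact EReal.sub_le_sub h le_rfl
    have hc := hα.apply_le (hsub hp.le) (hsub hb) (sub_nonneg.2 ht1) ht.le (by ring)
    unfold subQuad at hc
    rw [EReal.sub_le_iff_le_add (Or.inl (EReal.coe_ne_bot _)) (Or.inl (EReal.coe_ne_top _)),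
      ← EReal.coe_add] at hc
    have h1 := hmin _ _ hc
    have e1 : (1 - t) • p + t • x = p + t • (x - p) := by module
    have e2 : p + t • (x - p) - y = (p - y) + t • (x - p) := by abel
    have e3 : quad x = quad p + inner ℝ p (x - p) + quad (x - p) := by
      rw [← quad_add]; congr 1; abel
    have e4 : inner ℝ (y - p) (x - p) = - inner ℝ (p - y) (x - p) := by
      rw [← inner_neg_left, neg_sub]
    rw [e1, e2, quad_add, quad_add, quad_smul, inner_smul_right, inner_smul_right, e3] at h1
    rw [e4]
    refine le_of_mul_le_mul_left ?_ ht
    linear_combination h1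
  have hlim : Filter.Tendsto (fun t : ℝ => b + t * ((α + 1) * quad (x - p)))
      (nhdsWithin 0 (Set.Ioi 0)) (nhds (b + 0 * ((α + 1) * quad (x - p)))) :=
    Filter.Tendsto.mono_left (Continuous.tendsto (by fun_prop) 0) nhdsWithin_le_nhds
  rw [zero_mul, add_zero] at hlim
  refine ge_of_tendsto hlim ?_
  filter_upwards [Ioc_mem_nhdsGT zero_lt_one] with t ht using key t ht.1 ht.2

/-! ### Smoothness of `g^* □ Q` -/

/-- Fenchel–Young for `f` and for `Q`, both at `p`. -/
theorem le_infConv_conjugate {f : E → EReal} {p : E} {r : ℝ} (hp : f p = r) (y : E) :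
    ((inner ℝ p y - quad p - r : ℝ) : EReal) ≤
      infConv (conjugate f) (fun z => (quad z : EReal)) y := by
  refine le_iInf fun z => ?_
  have h1 : ((inner ℝ p z - r : ℝ) : EReal) ≤ conjugate f z := by
    refine le_trans ?_ (le_iSup _ p)
    rw [hp, EReal.coe_sub]
  refine le_trans ?_ (add_le_add_left h1 _)
  rw [← EReal.coe_add, EReal.coe_le_coe_iff]
  have h2 := quad_nonneg ((y - z) - p)
  rw [quad_sub, inner_sub_left, real_inner_comm p y, real_inner_comm p z] at h2
  linarith

theorem descent_infConv_conjugate [CompleteSpace E] {f : E → EReal}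
    (hf : IsGammaZero f) {α : ℝ} (hα0 : 0 ≤ α) (hα : IsConvex (subQuad f α)) (y : E) :
    ∃ (p : E) (s : ℝ), infConv (conjugate f) (fun z => (quad z : EReal)) y = s ∧
      ∀ y', infConv (conjugate f) (fun z => (quad z : EReal)) y' ≤
        ((s + inner ℝ p (y' - y) + quad (y' - y) / (α + 1) : ℝ) : EReal) := by
  obtain ⟨p, r, hp, hsg⟩ := hf.exists_prox_subgradient hα y
  have hup : ∀ y', infConv (conjugate f) (fun z => (quad z : EReal)) y' ≤
      ((inner ℝ p y - quad p - r + inner ℝ p (y' - y) + quad (y' - y) / (α + 1) : ℝ) :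
        EReal) := by
    intro y'
    have hγ : α + 1 ≠ 0 := by positivity
    set d := (1 / (α + 1)) • (y' - y) with hd
    have hd' : y' = y + (α + 1) • d := by
      rw [hd, smul_smul, mul_one_div_cancel hγ]; module
    -- Splits `y'` into `y - p + α • d` and `p + d`, sharing the increment `(α + 1) • d` so that the
    -- total cost is `(α + 1) * quad d`. No division by `α` occurs, so `α = 0` is covered.
    refine (iInf_le _ ((y - p) + α • d)).trans ?_
    have h1 : conjugate f ((y - p) + α • d) ≤
        ((inner ℝ p ((y - p) + α • d) - r + α * quad d : ℝ) : EReal) := by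
      refine iSup_le fun x => ?_
      rcases eq_or_ne (f x) ⊤ with hx | hx
      · simp [hx]
      · rw [← EReal.coe_toReal hx (hf.ne_bot x), ← EReal.coe_sub, EReal.coe_le_coe_iff]
        have h2 := hsg x (f x).toReal (EReal.coe_toReal hx (hf.ne_bot x)).ge
        have h3 := mul_nonneg hα0 (quad_nonneg ((x - p) - d))
        rw [quad_sub] at h3
        simp only [inner_add_right, inner_sub_right, inner_sub_left, inner_smul_right] at h2 h3 ⊢
        rw [real_inner_comm x y, real_inner_comm p y, real_inner_comm x p] at h2
        linarith
    refine (add_le_add_left h1 _).trans ?_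
    rw [← EReal.coe_add, EReal.coe_le_coe_iff]
    clear_value d
    have e1 : y' - (y - p + α • d) = p + d := by rw [hd']; module
    have e2 : y' - y = (α + 1) • d := by rw [hd']; module
    rw [e1, e2, quad_smul, quad_add]
    have e3 : inner ℝ p p = 2 * quad p := by rw [real_inner_self_eq_norm_sq]; unfold quad; ring
    simp only [inner_add_right, inner_sub_right, inner_smul_right, e3]
    apply le_of_eq
    field_simp
    ring
  refine ⟨p, inner ℝ p y - quad p - r, le_antisymm (by simpa [quad] using hup y)
    (le_infConv_conjugate hp y), hup⟩

/-! ### Conjugates of smooth functions -/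

/-- If `φ` is `σ`-smooth from above at every point, its conjugate is a supremum of quadratics
with curvature `σ⁻¹`. -/
theorem conjugate_le_iff_of_descent {φ : E → ℝ} {q : E → E} {c : ℝ} (hc : 0 < c)
    (h : ∀ v w, φ w ≤ φ v + inner ℝ (q v) (w - v) + quad (w - v) / c) (x : E) (ξ : ℝ) :
    conjugate (fun v => (φ v : EReal)) x ≤ ξ ↔
      ∀ v, inner ℝ v x - φ v + c * quad (x - q v) ≤ ξ := by
  have h0 : conjugate (fun v => (φ v : EReal)) x ≤ ξ ↔ ∀ v, inner ℝ v x - φ v ≤ ξ := by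
    unfold conjugate
    rw [iSup_le_iff]
    refine forall_congr' fun v => ?_
    rw [← EReal.coe_sub, EReal.coe_le_coe_iff]
  rw [h0]
  refine ⟨fun H v => ?_, fun H v => ?_⟩
  -- This point maximizes over `w` the lower bound of `⟪w, x⟫ - φ w` given by `h`.
  · have h1 := H (v + c • (x - q v))
    have h2 := h v (v + c • (x - q v))
    rw [add_sub_cancel_left, quad_smul, inner_smul_right] at h2
    have e1 : c ^ 2 * quad (x - q v) / c = c * quad (x - q v) := by field_simp
    have e2 : inner ℝ (x - q v) x - inner ℝ (q v) (x - q v) = 2 * quad (x - q v) := by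
      rw [real_inner_comm (x - q v) (q v), ← inner_sub_right, real_inner_self_eq_norm_sq]
      unfold quad; ring
    rw [inner_add_left, real_inner_smul_left] at h1
    rw [e1] at h2
    linear_combination h1 + h2 - c * e2
  · have := mul_nonneg hc.le (quad_nonneg (x - q v))
    linarith [H v]

theorem subQuad_le_coe_iff {f : E → EReal} {c ξ : ℝ} {x : E} :
    subQuad f c x ≤ ξ ↔ f x ≤ ((ξ + c * quad x : ℝ) : EReal) := by
  unfold subQuad
  rw [EReal.sub_le_iff_le_add (Or.inl (EReal.coe_ne_bot _)) (Or.inl (EReal.coe_ne_top _)),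
    ← EReal.coe_add]

theorem IsConvex.of_subQuad {f : E → EReal} {c : ℝ} (hc : 0 ≤ c) (hf : IsConvex (subQuad f c)) :
    IsConvex f := by
  rintro ⟨x, a⟩ hx ⟨y, b⟩ hy s t hs ht hst
  have hsub : ∀ {z : E} {r : ℝ}, f z ≤ r → subQuad f c z ≤ ((r - c * quad z : ℝ) : EReal) := by
    intro z r h
    rw [subQuad_le_coe_iff]; simpa using h
  have h1 := subQuad_le_coe_iff.1 (hf.apply_le (hsub hx) (hsub hy) hs ht hst)
  refine h1.trans ?_
  change _ ≤ ((s * a + t * b : ℝ) : EReal)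
  rw [EReal.coe_le_coe_iff, quad_add, quad_smul, quad_smul, real_inner_smul_left, inner_smul_right]
  have h2 := mul_nonneg (mul_nonneg hc (mul_nonneg hs ht)) (quad_nonneg (x - y))
  rw [quad_sub] at h2
  obtain rfl : s = 1 - t := by linarith
  linarith

/-- Removing `c * quad x` makes each quadratic in the supremum affine in `x`. -/
theorem isConvex_subQuad_conjugate {φ : E → ℝ} {q : E → E} {c : ℝ} (hc : 0 < c)
    (h : ∀ v w, φ w ≤ φ v + inner ℝ (q v) (w - v) + quad (w - v) / c) :
    IsConvex (subQuad (conjugate fun v => (φ v : EReal)) c) := by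
  have hiff : ∀ (x : E) (ξ : ℝ), subQuad (conjugate fun v => (φ v : EReal)) c x ≤ ξ ↔
      ∀ v, inner ℝ (v - c • q v) x - φ v + c * quad (q v) ≤ ξ := by
    intro x ξ
    rw [subQuad_le_coe_iff, conjugate_le_iff_of_descent hc h]
    refine forall_congr' fun v => ?_
    rw [quad_sub, inner_sub_left, real_inner_smul_left, real_inner_comm (q v) x]
    constructor <;> intro H <;> linarith
  rintro ⟨x, a⟩ hx ⟨y, b⟩ hy s t hs ht hst
  refine (hiff _ (s * a + t * b)).2 fun v => ?_
  have h1 := mul_le_mul_of_nonneg_left ((hiff x a).1 hx v) hs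
  have h2 := mul_le_mul_of_nonneg_left ((hiff y b).1 hy v) ht
  change inner ℝ _ (s • x + t • y) - _ + _ ≤ _
  rw [inner_add_right, inner_smul_right, inner_smul_right]
  obtain rfl : s = 1 - t := by linarith
  linarith

theorem lowerSemicontinuous_conjugate_sub_quad (φ : E → ℝ) :
    LowerSemicontinuous fun x =>
      conjugate (fun v => (φ v : EReal)) x - (quad x : EReal) := by
  have heq : (fun x => conjugate (fun v => (φ v : EReal)) x - (quad x : EReal)) =
      fun x => ⨆ v : E, ((inner ℝ v x - φ v - quad x : ℝ) : EReal) := by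
    funext x
    refine eq_of_forall_ge_iff fun a => ?_
    unfold conjugate
    rw [EReal.sub_le_iff_le_add (Or.inl (EReal.coe_ne_bot _)) (Or.inl (EReal.coe_ne_top _)),
      iSup_le_iff, iSup_le_iff]
    refine forall_congr' fun v => ?_
    rw [EReal.coe_sub, EReal.coe_sub]
    exact (EReal.sub_le_iff_le_add (Or.inl (EReal.coe_ne_bot _))
      (Or.inl (EReal.coe_ne_top _))).symm
  rw [heq]
  refine lowerSemicontinuous_iSup fun v => Continuous.lowerSemicontinuous ?_
  have := continuous_quad (E := E)
  exact continuous_coe_real_ereal.comp (by fun_prop)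

end ProxComp

theorem proposition5p5 {H G : Type*}
    [NormedAddCommGroup H] [InnerProductSpace ℝ H] [CompleteSpace H]
    [NormedAddCommGroup G] [InnerProductSpace ℝ G] [CompleteSpace G]
    (L : H →L[ℝ] G) (hL0 : 0 < ‖L‖) (hL1 : ‖L‖ ≤ 1)
    (α : ℝ) (hα : 0 ≤ α)
    (g : G → EReal) (hg : ProxComp.IsGammaZero g)
    (hgα : ProxComp.IsConvex (ProxComp.subQuad g α))
    (β : ℝ) (hβ : β = (α + 1) * ‖L‖ ^ (-2 : ℤ) - 1)
    (h : 0 < α ∨ ‖L‖ < 1) :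
    ProxComp.IsStronglyConvex β (ProxComp.proxComp L g) := by
  open ProxComp in
  have hc : β + 1 = (α + 1) / ‖L‖ ^ 2 := by
    rw [hβ, zpow_neg, div_eq_mul_inv]; norm_cast; ring
  have hc0 : 0 < β + 1 := by rw [hc]; positivity
  have hβ0 : 0 < β := by
    have hlt : ‖L‖ ^ 2 < α + 1 := by
      rcases h with h | h <;> nlinarith
    have : 1 < β + 1 := by rwa [hc, one_lt_div (by positivity)]
    linarith
  choose p s hs hdesc using descent_infConv_conjugate hg hα hgα
  set φ : H → ℝ := fun v => s (L v) with hφ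
  have hfun : (fun v : H => infConv (conjugate g) (fun y : G => (quad y : EReal)) (L v)) =
      fun v => (φ v : EReal) := funext fun v => hs (L v)
  have hprox : proxComp L g =
      fun x => conjugate (fun v => (φ v : EReal)) x - (quad x : EReal) := by
    funext x; unfold proxComp; rw [hfun]
  have hφd : ∀ v w, φ w ≤ φ v + inner ℝ (L.adjoint (p (L v))) (w - v) +
      quad (w - v) / (β + 1) := by
    intro v w
    have h1 := hdesc (L v) (L w)
    rw [hs, EReal.coe_le_coe_iff, ← map_sub] at h1
    rw [ContinuousLinearMap.adjoint_inner_left]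
    have h2 : quad (L (w - v)) / (α + 1) ≤ quad (w - v) / (β + 1) := by
      rw [hc, div_div_eq_mul_div]
      refine div_le_div_of_nonneg_right ?_ (by positivity)
      have := pow_le_pow_left₀ (norm_nonneg _) (L.le_opNorm (w - v)) 2
      rw [mul_pow] at this
      unfold quad
      linarith
    linarith
  have hconv : IsConvex (subQuad (proxComp L g) β) := by
    have : subQuad (proxComp L g) β =
        subQuad (conjugate fun v => (φ v : EReal)) (β + 1) := by
      funext x
      -- Comparing upper bounds moves the finite quadratic terms across without `EReal` subtraction
      -- identities.
      refine eq_of_forall_ge_iff fun a => ?_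
      rw [hprox]
      unfold subQuad
      have hiff : ∀ {u w : EReal} (r : ℝ), u - r ≤ w ↔ u ≤ w + r := fun r =>
        EReal.sub_le_iff_le_add (Or.inl (EReal.coe_ne_bot _)) (Or.inl (EReal.coe_ne_top _))
      rw [hiff, hiff, hiff, add_assoc, ← EReal.coe_add, add_one_mul]
    rw [this]
    exact isConvex_subQuad_conjugate hc0 hφd
  refine ⟨⟨fun x => ?_, ?_, ?_, hconv.of_subQuad hβ0.le⟩, hβ0, hconv⟩
  · have h1 : ((inner ℝ 0 x - φ 0 - quad x : ℝ) : EReal) ≤ proxComp L g x := by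
      rw [hprox, EReal.coe_sub, EReal.coe_sub]
      exact EReal.sub_le_sub (le_iSup (fun v : H => ((inner ℝ v x : ℝ) : EReal) - φ v) 0) le_rfl
    exact ne_bot_of_le_ne_bot (EReal.coe_ne_bot _) h1
  · obtain ⟨x₀, a, ha⟩ := hg.exists_eq_coe
    -- At `L.adjoint x₀` the linear term is `⟪x₀, L v⟫`, which Fenchel–Young at `x₀` bounds by `φ v
    -- + quad x₀ + a`.
    refine ⟨L.adjoint x₀, lt_of_le_of_lt ?_
      (EReal.coe_lt_top (quad x₀ + a - quad (L.adjoint x₀)))⟩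
    rw [hprox, EReal.coe_sub]
    refine EReal.sub_le_sub (iSup_le fun v => ?_) le_rfl
    have h1 := le_infConv_conjugate ha (L v)
    rw [hs, EReal.coe_le_coe_iff] at h1
    rw [← EReal.coe_sub, EReal.coe_le_coe_iff, ContinuousLinearMap.adjoint_inner_right,
      real_inner_comm]
    linarith
  · rw [hprox]
    exact lowerSemicontinuous_conjugate_sub_quad φ
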